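/- Let $R=\mathbb F_2\langle a,x : a=a^2x\rangle$ be the associative unital $\mathbb F_2$-algebra generated by $a$ and $x$ subject to the single relation $a=a^2x$. Let $N(R)$ be the set of nilpotent elements of $R$, and let $N^r_R(a)$ be the set of all $r\in N(R)$ for which there is a sequence $r_1,r_2,\dots$ in $R$ such that $r=r_1a$, $ar_i=r_{i+1}a$ for all $i\ge 1$, and $ar_k=0$ for some $k\ge 1$. Then: (1) $N(R)=N^r_R(a)$. (2) $R$ is an NR ring, i.e. $N(R)$ is a (not necessarily unital) subring of $R$. (3) $R$ is not right Dischinger, i.e. it is not true that every right strongly $\pi$-regular element of $R$ is strongly $\pi$-regular. In particular, an NR ring need not be right Dischinger. Here an element $b$ of a ring $S$ is right (respectively left) strongly $\pi$-regular if $b^n=b^{n+1}y$ (respectively $b^n=yb^{n+1}$) for some $y\in S$ and some integer $n\ge 1$, and it is strongly $\pi$-regular if it is both left and right strongly $\pi$-regular. -/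

import Mathlib

namespace Dischinger

/-! ### Strong regularity of elements and Dischinger's condition -/

section General

variable {S : Type*} [Ring S]

/-- `a ^ n = a ^ (n + 1) * y` for some `y` and some positive integer `n`. -/
def IsRightStronglyPiRegular (a : S) : Prop :=
  ∃ n : ℕ, 0 < n ∧ ∃ y : S, a ^ n = a ^ (n + 1) * y

/-- `a ^ n = y * a ^ (n + 1)` for some `y` and some positive integer `n`. -/
def IsLeftStronglyPiRegular (a : S) : Prop :=
  ∃ n : ℕ, 0 < n ∧ ∃ y : S, a ^ n = y * a ^ (n + 1)

/-- Strongly `π`-regular elements: both left and right strongly `π`-regular. -/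
def IsStronglyPiRegular (a : S) : Prop :=
  IsRightStronglyPiRegular a ∧ IsLeftStronglyPiRegular a

/-- `a = a ^ 2 * y` for some `y`. -/
def IsRightStronglyRegular (a : S) : Prop := ∃ y : S, a = a ^ 2 * y

/-- `a = y * a ^ 2` for some `y`. -/
def IsLeftStronglyRegular (a : S) : Prop := ∃ y : S, a = y * a ^ 2

/-- Strongly regular elements: both left and right strongly regular. -/
def IsStronglyRegular (a : S) : Prop :=
  IsRightStronglyRegular a ∧ IsLeftStronglyRegular a

variable (S) in
/-- A ring is right Dischinger if each of its right strongly `π`-regular elements is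
strongly `π`-regular. -/
def IsRightDischinger : Prop :=
  ∀ a : S, IsRightStronglyPiRegular a → IsStronglyPiRegular a

variable (S) in
/-- The other usual definition of right Dischinger rings agrees with the chosen one. -/
theorem isRightDischinger_iff :
    IsRightDischinger S ↔ ∀ a : S, IsRightStronglyRegular a → IsStronglyRegular a := by
  constructor
  · rintro h a ⟨y, hy⟩
    obtain ⟨-, m, -, z, hz⟩ := h a ⟨1, one_pos, y, by simpa using hy⟩
    refine ⟨⟨y, hy⟩, z, ?_⟩
    have key : ∀ j : ℕ, a = a ^ (j + 1) * y ^ j := by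
      intro j
      induction j with
      | zero => simp
      | succ j ih =>
        calc a = a ^ (j + 1) * y ^ j := ih
          _ = a ^ j * a * y ^ j := by rw [pow_succ]
          _ = a ^ j * (a ^ 2 * y) * y ^ j := by rw [← hy]
          _ = a ^ (j + 1 + 1) * y ^ (j + 1) := by
            rw [pow_succ' y, pow_add a (j + 1) 1, pow_succ a j, pow_one, pow_two]
            simp only [mul_assoc]
    calc a = a ^ (m + 1) * y ^ m := key m
      _ = a ^ m * a * y ^ m := by rw [pow_succ]
      _ = z * a ^ (m + 1) * a * y ^ m := by rw [← hz]
      _ = z * a * (a ^ (m + 1) * y ^ m) := by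
        rw [pow_succ' a m, mul_assoc z, mul_assoc a, ← pow_succ]
        simp only [mul_assoc, pow_succ']
      _ = z * a ^ 2 := by rw [← key m, pow_two, mul_assoc]
  · rintro h a ⟨n, hn, y, hy⟩
    refine ⟨⟨n, hn, y, hy⟩, ?_⟩
    have key : ∀ j : ℕ, a ^ n = a ^ (n + j) * y ^ j := by
      intro j
      induction j with
      | zero => simp
      | succ j ih =>
        calc a ^ n = a ^ (n + j) * y ^ j := ih
          _ = a ^ j * a ^ n * y ^ j := by rw [← pow_add, add_comm]
          _ = a ^ j * (a ^ (n + 1) * y) * y ^ j := by rw [← hy]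
          _ = a ^ (n + (j + 1)) * y ^ (j + 1) := by
            rw [pow_succ' y, show n + (j + 1) = j + (n + 1) by omega, pow_add a j]
            simp only [mul_assoc]
    obtain ⟨-, z, hz⟩ := h (a ^ n) ⟨y ^ n, by rw [pow_two, ← pow_add]; exact key n⟩
    refine ⟨n, hn, z * a ^ (n - 1), ?_⟩
    rw [mul_assoc, ← pow_add, show n - 1 + (n + 1) = n * 2 by omega, pow_mul]
    exact hz

variable (S) in
/-- A ring is an NR ring if its nilpotent elements form a (not necessarily unital) subring. -/
def IsNR : Prop :=
  ∃ T : NonUnitalSubring S, (T : Set S) = {r : S | IsNilpotent r}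

/-- The set `N^r_S(a)`: nilpotent elements `r` for which there is a sequence `r₁, r₂, …` with
`r = r₁ a`, `a rᵢ = rᵢ₊₁ a` for all `i ≥ 1`, and `a rₖ = 0` for some `k ≥ 1`
(the value of the sequence at `0` plays no role). -/
def rightNil (a : S) : Set S :=
  {r | IsNilpotent r ∧ ∃ s : ℕ → S, r = s 1 * a ∧
    (∀ i : ℕ, 1 ≤ i → a * s i = s (i + 1) * a) ∧ ∃ k : ℕ, 1 ≤ k ∧ a * s k = 0}

end General

/-! ### The ring `𝔽₂⟨a, x : a = a² x⟩` -/

/-- The two free generators. -/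
inductive Gen : Type
  | a
  | x

/-- The single defining relation `a = a² x` in the free unital algebra `𝔽₂⟨a, x⟩`. -/
inductive DefRel : FreeAlgebra (ZMod 2) Gen → FreeAlgebra (ZMod 2) Gen → Prop
  | rel : DefRel (FreeAlgebra.ι (ZMod 2) Gen.a)
      (FreeAlgebra.ι (ZMod 2) Gen.a ^ 2 * FreeAlgebra.ι (ZMod 2) Gen.x)

/-- The ring `𝔽₂⟨a, x : a = a² x⟩`, the quotient of the free algebra by the two-sided ideal
generated by the relation. -/
abbrev R : Type := RingQuot DefRel

/-- The image of the generator `a`. -/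
noncomputable def R.a : R :=
  RingQuot.mkAlgHom (ZMod 2) DefRel (FreeAlgebra.ι (ZMod 2) Gen.a)

/-- The image of the generator `x`. -/
noncomputable def R.x : R :=
  RingQuot.mkAlgHom (ZMod 2) DefRel (FreeAlgebra.ι (ZMod 2) Gen.x)

end Dischinger

namespace Dischinger

open Polynomial

/-! Rewriting a²x to a yields normal forms: a word in x and ax followed by a power of a. Hence R is
free as a right 𝔽₂[a]-module, right multiplication by a is injective, and R/Ra has the words in x
and ax as a basis.

The heart is that a nilpotent r lies in Ra (`exists_eq_mul_a_of_isNilpotent`). Otherwise m = r·1 is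
nonzero in R/Ra, without constant term, and the inverse z of 1 + r satisfies z·1 + z·m = 1. But z·m
contains longer words than z·1 (`LengthLT.quotRep_generator`), which is impossible.

Write r = s₁a; then as₁ is again nilpotent, and iterating produces the sequence. It reaches 0
because some aᵏ kills r (`exists_a_pow_mul_eq_zero`) and a cancels on the right. In any ring
`rightNil a` is closed under the ring operations, so R is NR. Finally a = a²x, whereas left strong
π-regularity of a would give 1 = ya after cancellation, contradicting R/Ra ≠ 0. -/

/-- Induction along the generators `a` and `x` of `R`. -/
theorem R.induction {P : R → Prop} (hc : ∀ c : ZMod 2, P (algebraMap (ZMod 2) R c))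
    (ha : P R.a) (hx : P R.x) (hadd : ∀ r s, P r → P s → P (r + s))
    (hmul : ∀ r s, P r → P s → P (r * s)) (r : R) : P r := by
  obtain ⟨f, rfl⟩ := RingQuot.mkAlgHom_surjective (ZMod 2) DefRel r
  induction f using FreeAlgebra.induction with
  | grade0 c => simpa using hc c
  | grade1 g => cases g; exacts [ha, hx]
  | mul u v hu hv => simpa using hmul _ _ hu hv
  | add u v hu hv => simpa using hadd _ _ hu hv

theorem R.a_sq_mul_x : R.a ^ 2 * R.x = R.a := by
  have h := RingQuot.mkAlgHom_rel (ZMod 2) DefRel.rel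
  rw [map_mul, map_pow] at h
  exact h.symm

/-- The algebra homomorphism out of `R` given by elements with `α = α² ξ`. -/
noncomputable def R.lift {S : Type*} [Ring S] [Algebra (ZMod 2) S] (α ξ : S)
    (h : α = α ^ 2 * ξ) : R →ₐ[ZMod 2] S :=
  RingQuot.liftAlgHom (ZMod 2) ⟨FreeAlgebra.lift (ZMod 2) (fun g => Gen.casesOn g α ξ), by
    rintro _ _ ⟨⟩
    simpa using h⟩

theorem R.lift_a {S : Type*} [Ring S] [Algebra (ZMod 2) S] (α ξ : S)
    (h : α = α ^ 2 * ξ) : R.lift α ξ h R.a = α := by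
  simp [R.lift, R.a]

theorem R.lift_x {S : Type*} [Ring S] [Algebra (ZMod 2) S] (α ξ : S)
    (h : α = α ^ 2 * ξ) : R.lift α ξ h R.x = ξ := by
  simp [R.lift, R.x]

/-! ### Modules of words

Words in the letters `x` (encoded by `true`) and `ax` (encoded by `false`) with coefficients in
`B`; the element `a` acts on coefficients of the empty word through a linear map `β`. -/

section WordModule

variable {B : Type*} [AddCommGroup B] [Module (ZMod 2) B] (β : B →ₗ[ZMod 2] B)

/-- The action of `a` on a multiple of a single word. -/
noncomputable def opAWord : List Bool → B →ₗ[ZMod 2] (List Bool →₀ B)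
  | [] => Finsupp.lsingle [] ∘ₗ β
  | true :: w => Finsupp.lsingle (false :: w)
  | false :: w => opAWord w

/-- The action of `a`. -/
noncomputable def opA : Module.End (ZMod 2) (List Bool →₀ B) :=
  Finsupp.lsum (ZMod 2) (opAWord β)

variable (B) in
/-- The action of `x`. -/
noncomputable def opX : Module.End (ZMod 2) (List Bool →₀ B) :=
  Finsupp.lsum (ZMod 2) fun w => Finsupp.lsingle (true :: w)

theorem opX_single (w : List Bool) (b : B) :
    opX B (Finsupp.single w b) = Finsupp.single (true :: w) b := by
  simp [opX]

theorem opA_single_nil (b : B) :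
    opA β (Finsupp.single [] b) = Finsupp.single [] (β b) := by
  simp [opA, opAWord]

theorem opA_single_true (w : List Bool) (b : B) :
    opA β (Finsupp.single (true :: w) b) = Finsupp.single (false :: w) b := by
  simp [opA, opAWord]

theorem opA_single_false (w : List Bool) (b : B) :
    opA β (Finsupp.single (false :: w) b) = opA β (Finsupp.single w b) := by
  simp [opA, opAWord]

/-- The first a merges with the new letter x into ax; the second absorbs that letter and acts on the
rest of the word, as a·ax = a demands. -/
theorem opA_eq : opA β = opA β ^ 2 * opX B := by
  refine Finsupp.lhom_ext fun w b => ?_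
  rw [pow_two, Module.End.mul_apply, Module.End.mul_apply, opX_single, opA_single_true,
    opA_single_false]

/-- The action of `R` on words with coefficients in `B`. -/
noncomputable def wordRep : R →ₐ[ZMod 2] Module.End (ZMod 2) (List Bool →₀ B) :=
  R.lift (opA β) (opX B) (opA_eq β)

theorem wordRep_a : wordRep β R.a = opA β := R.lift_a _ _ _

theorem wordRep_x : wordRep β R.x = opX B := R.lift_x _ _ _

/-- The element of `R` spelled by a word. -/
noncomputable def ofWord : List Bool → R
  | [] => 1
  | true :: w => R.x * ofWord w
  | false :: w => R.a * R.x * ofWord w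

/-- Evaluation of a combination of words in `R`. -/
noncomputable def evalWord (θ : B →ₗ[ZMod 2] R) : (List Bool →₀ B) →ₗ[ZMod 2] R :=
  Finsupp.lsum (ZMod 2) fun w => LinearMap.mulLeft (ZMod 2) (ofWord w) ∘ₗ θ

theorem evalWord_single (θ : B →ₗ[ZMod 2] R) (w : List Bool) (b : B) :
    evalWord θ (Finsupp.single w b) = ofWord w * θ b := by
  simp [evalWord]

/-- Evaluation of words is compatible with the actions of `R` modulo a left ideal. -/
theorem mul_evalWord_sub_mem (θ : B →ₗ[ZMod 2] R) (I : Submodule R R)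
    (hI : ∀ b, R.a * θ b - θ (β b) ∈ I) (r : R) :
    ∀ m, r * evalWord θ m - evalWord θ (wordRep β r m) ∈ I := by
  induction r using R.induction with
  | hc c =>
    intro m
    simp [Algebra.smul_def]
  | ha =>
    intro m
    rw [wordRep_a]
    induction m using Finsupp.induction_linear with
    | zero => simp
    | add f g hf hg =>
      rw [map_add, map_add, map_add, mul_add, add_sub_add_comm]
      exact I.add_mem hf hg
    | single w b =>
      induction w with
      | nil => simpa [opA_single_nil, evalWord_single, ofWord] using hI b
      | cons c w ih =>
        cases c with
        | true => simp [opA_single_true, evalWord_single, ofWord, mul_assoc]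
        | false =>
          rw [opA_single_false]
          rw [evalWord_single] at ih ⊢
          convert ih using 2
          rw [ofWord, ← mul_assoc, ← mul_assoc, ← mul_assoc, ← pow_two, R.a_sq_mul_x, mul_assoc]
  | hx =>
    intro m
    rw [wordRep_x]
    induction m using Finsupp.induction_linear with
    | zero => simp
    | add f g hf hg =>
      rw [map_add, map_add, map_add, mul_add, add_sub_add_comm]
      exact I.add_mem hf hg
    | single w b => simp [opX_single, evalWord_single, ofWord, mul_assoc]
  | hadd r s hr hs =>
    intro m
    have := I.add_mem (hr m) (hs m)
    rw [add_mul, map_add, LinearMap.add_apply, map_add, add_sub_add_comm]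
    exact this
  | hmul r s hr hs =>
    intro m
    have := I.add_mem (I.smul_mem r (hs m)) (hr (wordRep β s m))
    rw [smul_eq_mul, mul_sub, ← mul_assoc, sub_add_sub_cancel] at this
    rwa [map_mul, Module.End.mul_apply]

end WordModule

/-! ### Right cancellation of `a` -/

/-- The left regular representation of `R`. -/
noncomputable abbrev regRep : R →ₐ[ZMod 2] Module.End (ZMod 2) (List Bool →₀ (ZMod 2)[X]) :=
  wordRep (LinearMap.mulRight (ZMod 2) (X : (ZMod 2)[X]))

/-- Uniqueness of normal forms: the vector r·1 determines r. -/
theorem evalWord_regRep (r : R) :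
    evalWord (aeval R.a).toLinearMap (regRep r (Finsupp.single [] 1)) = r := by
  have h := mul_evalWord_sub_mem (LinearMap.mulRight (ZMod 2) (X : (ZMod 2)[X]))
    (aeval R.a).toLinearMap ⊥ (fun b => by
      have : Commute R.a (aeval R.a b) := by
        simpa using (Commute.all X b).map (aeval R.a)
      simp [this.eq]) r (Finsupp.single [] 1)
  rw [Submodule.mem_bot, sub_eq_zero, evalWord_single] at h
  simpa [ofWord] using h.symm

/-- In the regular representation, applying β to coefficients is right multiplication by a, which
commutes with the left action. -/
theorem wordRep_mapRange {B : Type*} [AddCommGroup B] [Module (ZMod 2) B] (β : B →ₗ[ZMod 2] B)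
    (r : R) : ∀ m, wordRep β r (Finsupp.mapRange.linearMap β m) =
      Finsupp.mapRange.linearMap β (wordRep β r m) := by
  induction r using R.induction with
  | hc c => intro m; simp only [AlgHom.commutes, Module.algebraMap_end_apply, map_smul]
  | ha =>
    intro m
    rw [wordRep_a]
    induction m using Finsupp.induction_linear with
    | zero => simp
    | add f g hf hg => simp only [map_add, hf, hg]
    | single w b =>
      induction w with
      | nil => simp [opA_single_nil]
      | cons c w ih =>
        cases c with
        | true => simp [opA_single_true]
        | false => simpa [opA_single_false] using ih
  | hx =>
    intro m
    rw [wordRep_x]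
    induction m using Finsupp.induction_linear with
    | zero => simp
    | add f g hf hg => simp only [map_add, hf, hg]
    | single w b => simp [opX_single]
  | hadd r s hr hs => intro m; simp only [map_add, LinearMap.add_apply, hr, hs]
  | hmul r s hr hs => intro m; simp only [map_mul, Module.End.mul_apply, hr, hs]

theorem eq_zero_of_mul_a_eq_zero {r : R} (h : r * R.a = 0) : r = 0 := by
  have h1 : regRep (r * R.a) (Finsupp.single [] 1) = 0 := by rw [h]; simp
  have h2 : opA (LinearMap.mulRight (ZMod 2) (X : (ZMod 2)[X])) (Finsupp.single [] 1) =
      Finsupp.mapRange.linearMap (LinearMap.mulRight (ZMod 2) X) (Finsupp.single [] 1) := by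
    simp [opA_single_nil]
  rw [map_mul, Module.End.mul_apply, wordRep_a, h2, wordRep_mapRange] at h1
  have h3 : regRep r (Finsupp.single [] 1) = 0 := by
    ext1 w
    have := DFunLike.congr_fun h1 w
    simpa using this
  rw [← evalWord_regRep r, h3, map_zero]

theorem mul_a_right_cancel {r s : R} (h : r * R.a = s * R.a) : r = s :=
  sub_eq_zero.mp (eq_zero_of_mul_a_eq_zero (by rw [sub_mul, h, sub_self]))

theorem mul_a_pow_right_cancel {r s : R} (n : ℕ) (h : r * R.a ^ n = s * R.a ^ n) : r = s := by
  induction n with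
  | zero => simpa using h
  | succ n ih =>
    rw [pow_succ, ← mul_assoc, ← mul_assoc] at h
    exact ih (mul_a_right_cancel h)

/-! ### The module `R / R a` -/

/-- The action of `R` on `R / R a`. -/
noncomputable abbrev quotRep : R →ₐ[ZMod 2] Module.End (ZMod 2) (List Bool →₀ ZMod 2) :=
  wordRep 0

theorem exists_eq_mul_a_of_quotRep_eq_zero {r : R} (h : quotRep r (Finsupp.single [] 1) = 0) :
    ∃ s, r = s * R.a := by
  have h1 := mul_evalWord_sub_mem 0 (Algebra.linearMap (ZMod 2) R) (Ideal.span {R.a})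
    (fun b => by
      have : R.a * algebraMap (ZMod 2) R b ∈ Ideal.span {R.a} := by
        rw [← Algebra.commutes]
        exact Ideal.mul_mem_left _ _ (Ideal.mem_span_singleton_self _)
      simpa using this) r (Finsupp.single [] 1)
  rw [h, evalWord_single, map_zero, sub_zero] at h1
  obtain ⟨s, hs⟩ := Ideal.mem_span_singleton'.mp h1
  exact ⟨s, by simpa [ofWord] using hs.symm⟩

/-- The augmentation of `R`. -/
noncomputable def R.aug : R →ₐ[ZMod 2] ZMod 2 := R.lift 0 0 (by simp)

theorem quotRep_apply_nil (r : R) : ∀ m, quotRep r m [] = R.aug r * m [] := by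
  induction r using R.induction with
  | hc c => intro m; simp
  | ha =>
    intro m
    rw [wordRep_a, R.aug, R.lift_a, zero_mul]
    induction m using Finsupp.induction_linear with
    | zero => simp
    | add f g hf hg => simp [hf, hg]
    | single w b =>
      induction w with
      | nil => simp [opA_single_nil]
      | cons c w ih =>
        cases c with
        | true => simp [opA_single_true]
        | false => simpa [opA_single_false] using ih
  | hx =>
    intro m
    rw [wordRep_x, R.aug, R.lift_x, zero_mul]
    induction m using Finsupp.induction_linear with
    | zero => simp
    | add f g hf hg => simp [hf, hg]
    | single w b => simp [opX_single]
  | hadd r s hr hs => intro m; simp [hr, hs, add_mul]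
  | hmul r s hr hs => intro m; simp [hr, hs, mul_assoc]

/-! ### Last letters and word lengths in R/Ra -/

/-- Appending a last letter. -/
noncomputable def snoc (c : Bool) : (List Bool →₀ ZMod 2) →ₗ[ZMod 2] (List Bool →₀ ZMod 2) :=
  Finsupp.lmapDomain _ _ fun w => w ++ [c]

theorem snoc_single (c : Bool) (w : List Bool) (b : ZMod 2) :
    snoc c (Finsupp.single w b) = Finsupp.single (w ++ [c]) b := by
  simp [snoc]

theorem snoc_apply (c : Bool) (m : List Bool →₀ ZMod 2) (w : List Bool) :
    snoc c m (w ++ [c]) = m w :=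
  Finsupp.mapDomain_apply (List.append_left_injective [c]) m w

theorem snoc_apply_ne {c d : Bool} (h : c ≠ d) (m : List Bool →₀ ZMod 2) (w : List Bool) :
    snoc c m (w ++ [d]) = 0 := by
  refine Finsupp.mapDomain_of_notMem_range _ _ ?_
  rintro ⟨v, hv⟩
  exact h (by simpa using (List.append_inj' hv rfl).2)

/-- Right multiplication by ax is well defined on R/Ra, since a·ax = a lies in Ra. -/
theorem quotRep_snoc_false (r : R) : ∀ m, quotRep r (snoc false m) = snoc false (quotRep r m) := by
  induction r using R.induction with
  | hc c => intro m; simp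
  | ha =>
    intro m
    rw [wordRep_a]
    induction m using Finsupp.induction_linear with
    | zero => simp
    | add f g hf hg => simp only [map_add, hf, hg]
    | single w b =>
      induction w with
      | nil => simp [opA_single_nil, snoc_single, opA_single_false]
      | cons c w ih =>
        cases c with
        | true => simp [opA_single_true, snoc_single]
        | false => simpa [opA_single_false, snoc_single] using ih
  | hx =>
    intro m
    rw [wordRep_x]
    induction m using Finsupp.induction_linear with
    | zero => simp
    | add f g hf hg => simp only [map_add, hf, hg]
    | single w b => simp [opX_single, snoc_single]
  | hadd r s hr hs => intro m; simp only [map_add, LinearMap.add_apply, hr, hs]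
  | hmul r s hr hs => intro m; simp only [map_mul, Module.End.mul_apply, hr, hs]

/-- Right multiplication by x is not well defined on R/Ra, since a·x = ax is nonzero there; the
error only involves words ending in ax. -/
theorem quotRep_snoc_true (r : R) :
    ∀ m, ∃ e, quotRep r (snoc true m) = snoc true (quotRep r m) + snoc false e := by
  induction r using R.induction with
  | hc c => intro m; exact ⟨0, by simp⟩
  | ha =>
    intro m
    rw [wordRep_a]
    induction m using Finsupp.induction_linear with
    | zero => exact ⟨0, by simp⟩
    | add f g hf hg =>
      obtain ⟨e, he⟩ := hf
      obtain ⟨e', he'⟩ := hg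
      exact ⟨e + e', by simp only [map_add, he, he']; abel⟩
    | single w b =>
      induction w with
      | nil =>
        exact ⟨Finsupp.single [] b, by
          simp [opA_single_nil, snoc_single, opA_single_true]⟩
      | cons c w ih =>
        cases c with
        | true => exact ⟨0, by simp [opA_single_true, snoc_single]⟩
        | false => simpa [opA_single_false, snoc_single] using ih
  | hx =>
    intro m
    rw [wordRep_x]
    induction m using Finsupp.induction_linear with
    | zero => exact ⟨0, by simp⟩
    | add f g hf hg =>
      obtain ⟨e, he⟩ := hf
      obtain ⟨e', he'⟩ := hg
      exact ⟨e + e', by simp only [map_add, he, he']; abel⟩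
    | single w b => exact ⟨0, by simp [opX_single, snoc_single]⟩
  | hadd r s hr hs =>
    intro m
    obtain ⟨e, he⟩ := hr m
    obtain ⟨e', he'⟩ := hs m
    exact ⟨e + e', by simp only [map_add, LinearMap.add_apply, he, he']; abel⟩
  | hmul r s hr hs =>
    intro m
    obtain ⟨e, he⟩ := hs m
    obtain ⟨e', he'⟩ := hr (quotRep s m)
    exact ⟨e' + quotRep r e, by
      simp only [map_mul, Module.End.mul_apply, map_add, he, he', quotRep_snoc_false]; abel⟩

theorem exists_eq_snoc_add_snoc (m : List Bool →₀ ZMod 2) (h : m [] = 0) :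
    ∃ u v, m = snoc true u + snoc false v := by
  have inj (c : Bool) : Function.Injective fun w : List Bool => w ++ [c] :=
    List.append_left_injective [c]
  refine ⟨m.comapDomain _ (inj true).injOn, m.comapDomain _ (inj false).injOn, ?_⟩
  ext w
  rcases List.eq_nil_or_concat w with rfl | ⟨w, c, rfl⟩
  · rw [h, Finsupp.add_apply, snoc, snoc, Finsupp.lmapDomain_apply, Finsupp.lmapDomain_apply,
      Finsupp.mapDomain_of_notMem_range, Finsupp.mapDomain_of_notMem_range, add_zero] <;> simp
  · rw [List.concat_eq_append, Finsupp.add_apply]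
    cases c
    · rw [snoc_apply, snoc_apply_ne (by simp), zero_add, Finsupp.comapDomain_apply]
    · rw [snoc_apply, snoc_apply_ne (by simp), add_zero, Finsupp.comapDomain_apply]

/-- All words occurring in `m` have length less than `n`. -/
def LengthLT (n : ℕ) (m : List Bool →₀ ZMod 2) : Prop := ∀ w, n ≤ w.length → m w = 0

theorem exists_lengthLT (m : List Bool →₀ ZMod 2) : ∃ n, LengthLT n m := by
  refine ⟨m.support.sup List.length + 1, fun w hw => ?_⟩
  by_contra hne
  have := Finset.le_sup (f := List.length) (Finsupp.mem_support_iff.mpr hne)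
  omega

theorem LengthLT.of_snoc {n : ℕ} {u v : List Bool →₀ ZMod 2}
    (h : LengthLT n (snoc true u + snoc false v)) : LengthLT (n - 1) u ∧ LengthLT (n - 1) v := by
  constructor <;> intro w hw
  · have := h (w ++ [true]) (by simp; omega)
    rwa [Finsupp.add_apply, snoc_apply, snoc_apply_ne (by simp), add_zero] at this
  · have := h (w ++ [false]) (by simp; omega)
    rwa [Finsupp.add_apply, snoc_apply, snoc_apply_ne (by simp), zero_add] at this

/-- Acting on a nonzero element produces words at least as long as acting on the generator, and
longer ones if the constant term vanishes. -/
theorem LengthLT.quotRep_generator (k : ℕ) : ∀ m : List Bool →₀ ZMod 2, LengthLT k m → m ≠ 0 →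
    ∀ (r : R) (n : ℕ), LengthLT n (quotRep r m) →
      LengthLT n (quotRep r (Finsupp.single [] 1)) ∧
        (m [] = 0 → LengthLT (n - 1) (quotRep r (Finsupp.single [] 1))) := by
  induction k with
  | zero =>
    intro m hm h0
    exact absurd (Finsupp.ext fun w => hm w (Nat.zero_le _)) h0
  | succ k ih =>
    have pos : ∀ m : List Bool →₀ ZMod 2, LengthLT (k + 1) m → m ≠ 0 → m [] = 0 →
        ∀ (r : R) (n : ℕ), LengthLT n (quotRep r m) →
          LengthLT (n - 1) (quotRep r (Finsupp.single [] 1)) := by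
      intro m hm h0 hnil r n hr
      obtain ⟨u, v, rfl⟩ := exists_eq_snoc_add_snoc m hnil
      obtain ⟨hu, hv⟩ := hm.of_snoc
      rw [map_add, quotRep_snoc_false] at hr
      by_cases hu0 : u = 0
      · subst hu0
        refine (ih v hv (by rintro rfl; simp at h0) r _ ?_).1
        rw [map_zero, map_zero, ← map_zero (snoc true)] at hr
        exact hr.of_snoc.2
      -- The error and the contribution of v all end in ax, so the words ending in x are exactly
      -- those of r·u with x appended.
      · obtain ⟨e, he⟩ := quotRep_snoc_true r u
        rw [he, add_assoc, ← map_add] at hr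
        exact (ih u hu hu0 r _ hr.of_snoc.1).1
    intro m hm h0 r n hr
    refine ⟨?_, fun hnil => pos m hm h0 hnil r n hr⟩
    by_cases hnil : m [] = 0
    · exact fun w hw => pos m hm h0 hnil r n hr w (by omega)
    have hone : m [] = 1 := by
      generalize m [] = c at hnil
      revert c
      decide
    obtain ⟨m', rfl⟩ : ∃ m', m = Finsupp.single [] 1 + m' :=
      ⟨m - Finsupp.single [] 1, by abel⟩
    have hnil' : m' [] = 0 := by simpa using hone
    rw [map_add] at hr
    by_cases h0' : m' = 0
    · simpa [h0'] using hr
    have hm' : LengthLT (k + 1) m' := by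
      intro w hw
      have hw0 : w ≠ [] := by rintro rfl; simp at hw
      simpa [Finsupp.single_apply, hw0.symm] using hm w hw
    -- As r·m = r·1 + r·m', a bound above n on r·1 passes to r·m', and `pos` then lowers the bound
    -- on r·1 by one.
    have descend : ∀ N, LengthLT (n + N) (quotRep r (Finsupp.single [] 1)) →
        LengthLT n (quotRep r (Finsupp.single [] 1)) := by
      intro N
      induction N with
      | zero => exact id
      | succ N ihN =>
        intro hN
        refine ihN (pos m' hm' h0' hnil' r (n + (N + 1)) fun w hw => ?_)
        have := hr w (by omega)
        rwa [Finsupp.add_apply, hN w hw, zero_add] at this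
    obtain ⟨N, hN⟩ := exists_lengthLT (quotRep r (Finsupp.single [] 1))
    exact descend N fun w hw => hN w (by omega)

/-! ### Nilpotent elements -/

theorem exists_eq_mul_a_of_isNilpotent {r : R} (hr : IsNilpotent r) : ∃ s, r = s * R.a := by
  refine exists_eq_mul_a_of_quotRep_eq_zero ?_
  set m := quotRep r (Finsupp.single [] 1) with hm
  by_contra h0
  have hnil : m [] = 0 := by
    rw [hm, quotRep_apply_nil, (hr.map R.aug).eq_zero, zero_mul]
  obtain ⟨z, hz⟩ := hr.isUnit_one_add.exists_left_inv
  have hsum : quotRep z (Finsupp.single [] 1) + quotRep z m = Finsupp.single [] 1 := by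
    have := congrArg (fun t => quotRep t (Finsupp.single [] 1)) hz
    simpa [mul_add] using this
  have hz1 : quotRep z (Finsupp.single [] 1) [] = 1 := by
    have := DFunLike.congr_fun hsum []
    rwa [Finsupp.add_apply, quotRep_apply_nil z m, hnil, mul_zero, add_zero,
      Finsupp.single_eq_same] at this
  obtain ⟨k, hk⟩ := exists_lengthLT m
  -- z·1 and z·m agree off the empty word, so they share the bound n + 1; since m has no constant
  -- term, the bound on z·1 improves to n.
  have step (n : ℕ) (hn : LengthLT (n + 1) (quotRep z (Finsupp.single [] 1))) :
      LengthLT n (quotRep z (Finsupp.single [] 1)) := by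
    refine (LengthLT.quotRep_generator k m hk h0 z (n + 1) fun w hw => ?_).2 hnil
    have := DFunLike.congr_fun hsum w
    have hw0 : [] ≠ w := by rintro rfl; simp at hw
    rwa [Finsupp.add_apply, hn w hw, zero_add, Finsupp.single_apply, if_neg hw0] at this
  obtain ⟨n, hn⟩ := exists_lengthLT (quotRep z (Finsupp.single [] 1))
  have hzero : LengthLT 0 (quotRep z (Finsupp.single [] 1)) := by
    induction n with
    | zero => exact hn
    | succ n ih => exact ih (step n hn)
  rw [hzero [] le_rfl] at hz1
  exact zero_ne_one hz1

/-- Left multiplication by a large power of `a` turns any element into a polynomial in `a`. -/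
theorem exists_a_pow_mul_eq_aeval (r : R) :
    ∃ (k : ℕ) (f : (ZMod 2)[X]), R.a ^ k * r = aeval R.a f := by
  induction r using R.induction with
  | hc c => exact ⟨0, C c, by simp⟩
  | ha => exact ⟨0, X, by simp⟩
  | hx => exact ⟨2, X, by rw [R.a_sq_mul_x, aeval_X]⟩
  | hadd r s hr hs =>
    obtain ⟨k, f, hf⟩ := hr
    obtain ⟨l, g, hg⟩ := hs
    refine ⟨k + l, X ^ l * f + X ^ k * g, ?_⟩
    simp only [map_add, map_mul, map_pow, aeval_X, ← hf, ← hg, mul_add, ← mul_assoc, ← pow_add]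
    rw [add_comm l k]
  | hmul r s hr hs =>
    obtain ⟨k, f, hf⟩ := hr
    obtain ⟨l, g, hg⟩ := hs
    refine ⟨l + k, f * g, ?_⟩
    have hc : R.a ^ l * aeval R.a f = aeval R.a f * R.a ^ l := by
      rw [← aeval_X (R := ZMod 2) R.a, ← map_pow, aeval_X, ← map_mul, ← map_mul, mul_comm]
    rw [pow_add, mul_assoc, ← mul_assoc _ r, hf, ← mul_assoc, hc, mul_assoc, hg, map_mul]

/-- The homomorphism to Laurent polynomials with `a ↦ T` and `x ↦ T⁻¹`. -/
noncomputable def R.toLaurent : R →ₐ[ZMod 2] LaurentPolynomial (ZMod 2) :=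
  R.lift (LaurentPolynomial.T 1) (LaurentPolynomial.T (-1)) (by
    rw [LaurentPolynomial.T_pow, ← LaurentPolynomial.T_add]
    norm_num)

theorem R.toLaurent_aeval (f : (ZMod 2)[X]) :
    R.toLaurent (aeval R.a f) = Polynomial.toLaurentAlg f := by
  have : R.toLaurent R.a = Polynomial.toLaurentAlg (X : (ZMod 2)[X]) := by
    rw [R.toLaurent, R.lift_a]
    simp
  rw [← aeval_algHom_apply, this, aeval_algHom_apply, aeval_X_left_apply]

/-- Laurent polynomials are reduced, so r maps to 0; the polynomial aᵏr then vanishes because 𝔽₂[X]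
embeds in them. -/
theorem exists_a_pow_mul_eq_zero {r : R} (hr : IsNilpotent r) : ∃ k : ℕ, R.a ^ k * r = 0 := by
  obtain ⟨k, f, hf⟩ := exists_a_pow_mul_eq_aeval r
  refine ⟨k, ?_⟩
  have h := congrArg R.toLaurent hf
  rw [map_mul, (hr.map R.toLaurent).eq_zero, mul_zero, R.toLaurent_aeval] at h
  have hf0 : f = 0 := Polynomial.toLaurent_injective (by simpa using h.symm)
  rw [hf, hf0, map_zero]

theorem isNilpotent_mul_comm {S : Type*} [Ring S] {r s : S} (h : IsNilpotent (r * s)) :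
    IsNilpotent (s * r) := by
  obtain ⟨n, hn⟩ := h
  refine ⟨n + 1, ?_⟩
  have key : ∀ m : ℕ, (s * r) ^ (m + 1) = s * (r * s) ^ m * r := by
    intro m
    induction m with
    | zero => simp
    | succ m ih => rw [pow_succ, ih, pow_succ (r * s)]; simp only [mul_assoc]
  rw [key, hn, mul_zero, zero_mul]

theorem isNilpotent_iff_mem_rightNil (r : R) : IsNilpotent r ↔ r ∈ rightNil R.a := by
  refine ⟨fun hr => ?_, fun h => h.1⟩
  choose g hg using fun t : {t : R // IsNilpotent t} => exists_eq_mul_a_of_isNilpotent t.2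
  let next (t : {t : R // IsNilpotent t}) : {t : R // IsNilpotent t} :=
    ⟨R.a * g t, isNilpotent_mul_comm (hg t ▸ t.2)⟩
  let t (i : ℕ) : {t : R // IsNilpotent t} := next^[i] ⟨r, hr⟩
  have ht (i : ℕ) : (t (i + 1)).1 = R.a * g (t i) := by
    simp only [t, Function.iterate_succ_apply', next]
  have hpow (i : ℕ) : R.a ^ i * r = (t i).1 * R.a ^ i := by
    induction i with
    | zero => simp [t]
    | succ i ih =>
      rw [pow_succ', mul_assoc, ih, hg (t i), ht, ← pow_succ', pow_succ']
      simp only [mul_assoc]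
  obtain ⟨k, hk⟩ := exists_a_pow_mul_eq_zero hr
  refine ⟨hr, fun i => g (t (i - 1)), hg (t 0), ?_, k + 1, by omega, ?_⟩
  · rintro (_ | i) hi
    · omega
    · change R.a * g (t i) = g (t (i + 1)) * R.a
      rw [← ht, hg (t (i + 1))]
  · change R.a * g (t k) = 0
    rw [← ht]
    -- The term t (k + 1) satisfies t (k + 1) aᵏ⁺¹ = aᵏ⁺¹ r = 0.
    refine mul_a_pow_right_cancel (k + 1) ?_
    rw [← hpow, pow_succ', mul_assoc, hk, mul_zero, zero_mul]

/-! ### The set `rightNil a` is a subring -/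

section RightNil

variable {S : Type*} [Ring S] {a : S}

/-- Moving powers of a to the right gives rᵏ ∈ Saᵏ, hence rᵏ⁺¹ ∈ Saᵏs₁a = S(asₖ)aᵏ = 0. -/
theorem isNilpotent_of_sequence {r : S} {s : ℕ → S} (hr : r = s 1 * a)
    (hs : ∀ i, 1 ≤ i → a * s i = s (i + 1) * a) {k : ℕ} (hk : 1 ≤ k) (h0 : a * s k = 0) :
    IsNilpotent r := by
  have move : ∀ n : ℕ, a ^ n * s 1 = s (n + 1) * a ^ n := by
    intro n
    induction n with
    | zero => simp
    | succ n ih =>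
      rw [pow_succ', mul_assoc, ih, ← mul_assoc, hs _ (by omega), mul_assoc]
  have key : ∀ n : ℕ, ∃ c, r ^ n = c * a ^ n := by
    intro n
    induction n with
    | zero => exact ⟨1, by simp⟩
    | succ n ih =>
      obtain ⟨c, hc⟩ := ih
      exact ⟨c * s (n + 1), by
        rw [pow_succ, hc, hr, mul_assoc, ← mul_assoc _ (s 1), move, pow_succ]
        simp only [mul_assoc]⟩
  obtain ⟨c, hc⟩ := key k
  refine ⟨k + 1, ?_⟩
  obtain ⟨j, rfl⟩ : ∃ j, k = j + 1 := ⟨k - 1, by omega⟩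
  rw [pow_succ, hc, hr, mul_assoc, ← mul_assoc _ (s 1), pow_succ', mul_assoc a, move,
    ← mul_assoc a, h0, zero_mul, zero_mul, mul_zero]

/-- Nilpotency is automatic, and a sequence may be replaced by zero after index k. Eventual
vanishing lets two sequences be combined termwise. -/
theorem mem_rightNil_iff {r : S} : r ∈ rightNil a ↔ ∃ s : ℕ → S, r = s 1 * a ∧
    (∀ i : ℕ, 1 ≤ i → a * s i = s (i + 1) * a) ∧ ∃ K : ℕ, ∀ k, K ≤ k → a * s k = 0 := by
  constructor
  · rintro ⟨-, s, h1, hs, k, hk, h0⟩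
    refine ⟨fun i => if i ≤ k then s i else 0, by simp [hk, h1], fun i hi => ?_, k, fun i hi => ?_⟩
    · rcases lt_trichotomy i k with h | rfl | h
      · simp [h.le, Nat.succ_le_of_lt h, hs i hi]
      · simp [h0]
      · simp [show ¬ i ≤ k by omega, show ¬ i + 1 ≤ k by omega]
    · rcases hi.eq_or_lt with rfl | h
      · simp [h0]
      · simp [show ¬ i ≤ k by omega]
  · rintro ⟨s, h1, hs, K, hK⟩
    exact ⟨isNilpotent_of_sequence h1 hs (Nat.le_add_left 1 K) (hK _ (by omega)), s, h1, hs,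
      K + 1, by omega, hK _ (by omega)⟩

variable (a) in
/-- The set `rightNil a` as a non-unital subring. -/
def rightNilSubring : NonUnitalSubring S where
  carrier := rightNil a
  zero_mem' := mem_rightNil_iff.mpr ⟨fun _ => 0, by simp, by simp, 0, by simp⟩
  add_mem' := by
    intro r r' hr hr'
    obtain ⟨s, h1, hs, K, hK⟩ := mem_rightNil_iff.mp hr
    obtain ⟨s', h1', hs', K', hK'⟩ := mem_rightNil_iff.mp hr'
    refine mem_rightNil_iff.mpr ⟨fun i => s i + s' i, by rw [h1, h1', add_mul], fun i hi => ?_,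
      max K K', fun k hk => ?_⟩
    · rw [mul_add, hs i hi, hs' i hi, add_mul]
    · rw [mul_add, hK k (le_trans (le_max_left _ _) hk), hK' k (le_trans (le_max_right _ _) hk),
        add_zero]
  neg_mem' := by
    intro r hr
    obtain ⟨s, h1, hs, K, hK⟩ := mem_rightNil_iff.mp hr
    refine mem_rightNil_iff.mpr ⟨fun i => -s i, by rw [h1, neg_mul], fun i hi => ?_, K,
      fun k hk => ?_⟩
    · rw [mul_neg, hs i hi, neg_mul]
    · rw [mul_neg, hK k hk, neg_zero]
  mul_mem' := by
    intro r r' hr hr'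
    obtain ⟨s, h1, hs, K, hK⟩ := mem_rightNil_iff.mp hr
    obtain ⟨s', h1', hs', K', hK'⟩ := mem_rightNil_iff.mp hr'
    -- The witness is read off from rr' = (s₁ a s₁')a.
    refine mem_rightNil_iff.mpr ⟨fun i => s i * a * s' i, by rw [h1, h1']; simp only [mul_assoc],
      fun i hi => ?_, K, fun k hk => ?_⟩
    · rw [← mul_assoc, ← mul_assoc, hs i hi, mul_assoc _ a (s' i), hs' i hi]
      simp only [mul_assoc]
    · rw [← mul_assoc, ← mul_assoc, hK k hk, zero_mul, zero_mul]

end RightNil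

/-! ### Failure of the Dischinger condition and conclusion -/

theorem not_isRightDischinger_R : ¬ IsRightDischinger R := by
  intro h
  obtain ⟨-, n, -, y, hy⟩ := h R.a ⟨1, one_pos, R.x, by
    rw [pow_one, one_add_one_eq_two, R.a_sq_mul_x]⟩
  have h1 : 1 = y * R.a := mul_a_pow_right_cancel n (by rw [one_mul, mul_assoc, ← pow_succ', hy])
  have h2 := congrArg (fun t => quotRep t (Finsupp.single [] 1)) h1
  simp [wordRep_a, opA_single_nil] at h2

end Dischinger

theorem theorem3p4 :
    {r : Dischinger.R | IsNilpotent r} = Dischinger.rightNil Dischinger.R.a ∧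
      Dischinger.IsNR Dischinger.R ∧
      ¬ Dischinger.IsRightDischinger Dischinger.R := by
  have h : {r : Dischinger.R | IsNilpotent r} = Dischinger.rightNil Dischinger.R.a :=
    Set.ext Dischinger.isNilpotent_iff_mem_rightNil
  exact ⟨h, ⟨Dischinger.rightNilSubring Dischinger.R.a, h.symm⟩,
    Dischinger.not_isRightDischinger_R⟩
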